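/- Let $\mathbb{R}_+=(0,\infty)$, $\mathbb{N}=\{0,1,2,\dots\}$, and $\Delta f(x)=f(x+1)-f(x)$. For $p,r\in\mathbb{N}$ consider the following sets of functions $g\colon\mathbb{R}_+\to\mathbb{R}$. - $\mathcal{C}^r$: the $r$ times continuously differentiable functions on $\mathbb{R}_+$. - $\mathcal{D}^p_{\mathbb{N}}$ (resp. $\mathcal{D}^p_{\mathbb{R}}$): the functions $g$ with $\Delta^p g(x)\to 0$ as $x\to\infty$ over the integers (resp. over the reals). - $\mathcal{K}^p$: the functions that are $p$-convex on some interval $[a,\infty)$ with $a>0$, or $p$-concave on some such interval. Here $g$ is $p$-convex (resp. $p$-concave) on $I$ if all its divided differences satisfy $g[x_0,\dots,x_{p+1}]\ge 0$ (resp. $\le 0$) for all points $x_0<\dots<x_{p+1}$ of $I$. One has $\mathcal{D}^p_{\mathbb{N}}\cap\mathcal{K}^p=\mathcal{D}^p_{\mathbb{R}}\cap\mathcal{K}^p$, and this set is denoted $\mathcal{D}^p\cap\mathcal{K}^p$. For $n\ge 1$ let $$f^p_n[g](x)=-g(x)+\sum_{k=1}^{n-1}\bigl(g(k)-g(x+k)\bigr)+\sum_{j=1}^{p}\binom{x}{j}\,\Delta^{j-1}g(n),\qquad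 x>0.$$ For $g\in\bigcup_{q\ge 0}(\mathcal{D}^q\cap\mathcal{K}^q)$, let $\Sigma g\colon\mathbb{R}_+\to\mathbb{R}$ be the pointwise limit of $f^q_n[g]$ as $n\to\infty$, where $q$ is such that $g\in\mathcal{D}^q\cap\mathcal{K}^q$ (the limit exists and does not depend on the choice of such a $q$). **Theorem.** Let $p,r\in\mathbb{N}$ and let $g\in\mathcal{C}^r\cap\mathcal{D}^p_{\mathbb{N}}\cap\mathcal{K}^{\max\{p,r\}}$. Then $f^p_n[g](x)\to\Sigma g(x)$ as $n\to\infty$ for every $x>0$, and the following assertions hold. (a) $\Sigma g\in\mathcal{C}^r\cap\mathcal{D}^{p+1}_{\mathbb{R}}\cap\mathcal{K}^{\max\{p,r\}}$. (b) Each $f^p_n[g]$ with $n\ge 1$ lies in $\mathcal{C}^r$, and the sequence $n\mapsto D^r f^p_n[g]$ converges uniformly on every bounded subset of $\mathbb{R}_+$ to $D^r\Sigma g$. -/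

import Mathlib

open Filter Topology Set

/- A function `ℝ₊ → ℝ`, with `ℝ₊ = (0, ∞)`, is represented by a function `ℝ → ℝ`. Every notion
below depends only on the values taken on `(0, ∞)`. -/

namespace LogGammaType

/-- The divided difference `f[x₀, …, xₙ]` at pairwise distinct points `x₀, …, xₙ`. -/
noncomputable def dividedDiff (f : ℝ → ℝ) {n : ℕ} (x : Fin (n + 1) → ℝ) : ℝ :=
  ∑ k, f (x k) / ∏ j ∈ Finset.univ.erase k, (x k - x j)

/-- `f` is convex of order `p` on `I`: all its divided differences at `p + 2` points
`x₀ < ⋯ < x_{p+1}` of `I` are nonnegative. -/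
def ConvexOfOrder (p : ℕ) (I : Set ℝ) (f : ℝ → ℝ) : Prop :=
  ∀ x : Fin (p + 1 + 1) → ℝ, StrictMono x → (∀ i, x i ∈ I) → 0 ≤ dividedDiff f x

/-- `f` is concave of order `p` on `I`: all its divided differences at `p + 2` points
`x₀ < ⋯ < x_{p+1}` of `I` are nonpositive. -/
def ConcaveOfOrder (p : ℕ) (I : Set ℝ) (f : ℝ → ℝ) : Prop :=
  ∀ x : Fin (p + 1 + 1) → ℝ, StrictMono x → (∀ i, x i ∈ I) → dividedDiff f x ≤ 0

/-- The set `𝒦ᵖ₊` of eventually `p`-convex functions on `ℝ₊`. -/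
def KPlus (p : ℕ) : Set (ℝ → ℝ) := {f | ∃ a : ℝ, 0 < a ∧ ConvexOfOrder p (Ici a) f}

/-- The set `𝒦ᵖ₋` of eventually `p`-concave functions on `ℝ₊`. -/
def KMinus (p : ℕ) : Set (ℝ → ℝ) := {f | ∃ a : ℝ, 0 < a ∧ ConcaveOfOrder p (Ici a) f}

/-- The set `𝒦ᵖ = 𝒦ᵖ₊ ∪ 𝒦ᵖ₋`. -/
def K (p : ℕ) : Set (ℝ → ℝ) := KPlus p ∪ KMinus p

/-- The set `𝒞ʳ` of `r` times continuously differentiable functions on `ℝ₊`. -/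
def C (r : ℕ) : Set (ℝ → ℝ) := {f | ContDiffOn ℝ r f (Ioi 0)}

/-- The set `𝒟ᵖ_ℕ`: `Δᵖ g(n) → 0` as `n → ∞` over the integers, with `Δ f(x) = f(x + 1) - f(x)`. -/
def DNat (p : ℕ) : Set (ℝ → ℝ) :=
  {g | Tendsto (fun n : ℕ => (fwdDiff (1 : ℝ))^[p] g (n : ℝ)) atTop (𝓝 0)}

/-- The set `𝒟ᵖ_ℝ`: `Δᵖ g(x) → 0` as `x → ∞` over the reals. -/
def DReal (p : ℕ) : Set (ℝ → ℝ) :=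
  {g | Tendsto (fun x : ℝ => (fwdDiff (1 : ℝ))^[p] g x) atTop (𝓝 0)}

/-- The function `fᵖₙ[g]`, for `n ≥ 1`:
`fᵖₙ[g](x) = -g(x) + ∑_{k=1}^{n-1} (g(k) - g(x+k)) + ∑_{j=1}^{p} (x choose j) Δ^{j-1} g(n)`. -/
noncomputable def fSeq (p n : ℕ) (g : ℝ → ℝ) (x : ℝ) : ℝ :=
  -g x + ∑ k ∈ Finset.Icc 1 (n - 1), (g k - g (x + k))
    + ∑ j ∈ Finset.Icc 1 p, Ring.choose x j * (fwdDiff (1 : ℝ))^[j - 1] g (n : ℝ)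

/-- The least `p` with `g ∈ 𝒟ᵖ ∩ 𝒦ᵖ`, for `g` in the domain `⋃ₚ (𝒟ᵖ ∩ 𝒦ᵖ)` of `Σ`. -/
noncomputable def order (g : ℝ → ℝ) : ℕ := sInf {p | g ∈ DNat p ∩ K p}

/-- The map `Σ`: for `g ∈ ⋃ₚ (𝒟ᵖ ∩ 𝒦ᵖ)`, the function `Σ g` is the pointwise limit on `ℝ₊` of
`fᵖₙ[g]` as `n → ∞`, for any `p` with `g ∈ 𝒟ᵖ ∩ 𝒦ᵖ`. The limit does not depend on `p`, and the
definition takes the least one. -/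
noncomputable def Sig (g : ℝ → ℝ) (x : ℝ) : ℝ :=
  limUnder atTop (fun n : ℕ => fSeq (order g) n g x)

end LogGammaType

/-!
Let `m = max p r`. The increment `fSeq m (n + 1) g - fSeq m n g` is minus the error of interpolating
`x ↦ g (n + x)` at `x = 0, …, m` (`fSeq_succ_sub`). By Rolle's theorem the `r`-th derivative of
this error is again an interpolation error, now of `D^r g` at `m - r + 1` points. The function
`D^r g` is convex of order `q = m - r` if `g` is convex of order `m`
(`convexOfOrder_iteratedDeriv`), so its divided differences at `q + 1` points increase with the
points (`ConvexOfOrder.divDiff_le_of_lt`). On a bounded set the error is therefore at most a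
constant times `T (n + N) - T (n - q - 1)`, where `T y` is the divided difference of `D^r g` at
`y, y + 1, …, y + q` (`abs_iteratedDeriv_interpolation_error_le`). These bounds have a telescoping
sum, and `T` is bounded along the integers because `T (n - q - 1)` is at most a constant times
`Δ^m g(n)`, which tends to `0`. Hence all derivatives of `fSeq m n g` up to order `r` converge
uniformly on bounded sets (`exists_tendstoUniformlyOn_fSeq`).

Passing from `m` down to `p`, or to the order of `g` used in the definition of `Sig`, changes the
sequence by polynomials with coefficients `Δ^j g(n) → 0`, so the limit is the same
(`tendstoUniformlyOn_fSeq_of_le`, `tendsto_fSeq_iff_of_le`). This identifies the limit as `Sig g`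
and gives its smoothness. Divided differences of `fSeq m n g` at `m + 2` points are sums of those
of translates of `-g` (`divDiff_fSeq`), so `Sig g` is concave of order `m` where `g` is convex of
order `m`. Finally `Δ (Sig g) = g` (`Sig_add_one_sub`), and `Δ^p g` tends to `0` over the reals
since, by monotonicity, it does so over the integers (`mem_DReal_of_mem_K`); for this `g` has to be
in `K p`, which contains `K m` (`K_antitone`).
-/

namespace LogGammaType

/-! ### Divided differences over finite sets -/

/-- The divided difference of `f` at the points of a finite set `s`. Divided differences are
symmetric in their arguments, so this loses nothing against `dividedDiff` at distinct points, and
adding or exchanging points becomes insertion in a set. -/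
noncomputable def divDiff (f : ℝ → ℝ) (s : Finset ℝ) : ℝ :=
  ∑ x ∈ s, f x / ∏ y ∈ s.erase x, (x - y)

lemma dividedDiff_eq_divDiff (f : ℝ → ℝ) {n : ℕ} {x : Fin (n + 1) → ℝ}
    (hx : Function.Injective x) : dividedDiff f x = divDiff f (Finset.univ.image x) := by
  unfold dividedDiff divDiff
  rw [Finset.sum_image hx.injOn]
  refine Finset.sum_congr rfl fun k _ => ?_
  rw [← Finset.image_erase hx, Finset.prod_image hx.injOn]

lemma divDiff_congr {f g : ℝ → ℝ} {s : Finset ℝ} (h : ∀ x ∈ s, f x = g x) :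
    divDiff f s = divDiff g s :=
  Finset.sum_congr rfl fun x hx => by rw [h x hx]

lemma divDiff_neg (f : ℝ → ℝ) (s : Finset ℝ) : divDiff (-f) s = -divDiff f s := by
  simp [divDiff, neg_div]

lemma divDiff_add (f g : ℝ → ℝ) (s : Finset ℝ) :
    divDiff (fun x => f x + g x) s = divDiff f s + divDiff g s := by
  simp [divDiff, add_div, Finset.sum_add_distrib]

lemma divDiff_sub (f g : ℝ → ℝ) (s : Finset ℝ) :
    divDiff (fun x => f x - g x) s = divDiff f s - divDiff g s := by
  simp [divDiff, sub_div, Finset.sum_sub_distrib]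

lemma divDiff_div_const (f : ℝ → ℝ) (c : ℝ) (s : Finset ℝ) :
    divDiff (fun x => f x / c) s = divDiff f s / c := by
  simp only [divDiff, Finset.sum_div]
  exact Finset.sum_congr rfl fun x _ => div_right_comm _ _ _

lemma divDiff_sum {ι : Type*} (t : Finset ι) (f : ι → ℝ → ℝ) (s : Finset ℝ) :
    divDiff (fun x => ∑ i ∈ t, f i x) s = ∑ i ∈ t, divDiff (f i) s := by
  simp only [divDiff, Finset.sum_div]
  exact Finset.sum_comm

lemma divDiff_comp_add_right (f : ℝ → ℝ) (c : ℝ) (s : Finset ℝ) :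
    divDiff (fun x => f (x + c)) s = divDiff f (s.image (· + c)) := by
  unfold divDiff
  have hinj : Function.Injective fun x : ℝ => x + c := add_left_injective c
  rw [Finset.sum_image hinj.injOn]
  refine Finset.sum_congr rfl fun k _ => ?_
  rw [← Finset.image_erase hinj, Finset.prod_image hinj.injOn]
  simp

lemma tendsto_divDiff {ι : Type*} {l : Filter ι} {F : ι → ℝ → ℝ} {f : ℝ → ℝ} {s : Finset ℝ}
    (h : ∀ x ∈ s, Tendsto (fun i => F i x) l (𝓝 (f x))) :
    Tendsto (fun i => divDiff (F i) s) l (𝓝 (divDiff f s)) :=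
  tendsto_finsetSum _ fun x hx => (h x hx).div_const _

lemma divDiff_insert (f : ℝ → ℝ) {a : ℝ} {s : Finset ℝ} (ha : a ∉ s) :
    divDiff f (insert a s) =
      f a / ∏ y ∈ s, (a - y) + ∑ x ∈ s, f x / ((x - a) * ∏ y ∈ s.erase x, (x - y)) := by
  unfold divDiff
  rw [Finset.sum_insert ha, Finset.erase_insert ha]
  congr 1
  refine Finset.sum_congr rfl fun x hx => ?_
  have hxa : x ≠ a := fun h => ha (h ▸ hx)
  rw [Finset.erase_insert_of_ne hxa.symm, Finset.prod_insert (by simp [ha])]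

/-- The recursion for divided differences. -/
lemma divDiff_insert_sub (f : ℝ → ℝ) {a b : ℝ} {s : Finset ℝ} (ha : a ∉ s) (hb : b ∉ s)
    (hab : a ≠ b) :
    divDiff f (insert b s) - divDiff f (insert a s) =
      (b - a) * divDiff f (insert a (insert b s)) := by
  have hba : b - a ≠ 0 := sub_ne_zero.2 hab.symm
  have hab' : a - b ≠ 0 := sub_ne_zero.2 hab
  rw [divDiff_insert f (a := a) (s := insert b s) (by simp [ha, hab]), divDiff_insert f ha,
    divDiff_insert f hb, Finset.sum_insert hb, Finset.erase_insert hb, Finset.prod_insert hb]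
  have hsum : (b - a) * ∑ x ∈ s, f x / ((x - a) * ∏ y ∈ (insert b s).erase x, (x - y)) =
      ∑ x ∈ s, f x / ((x - b) * ∏ y ∈ s.erase x, (x - y)) -
      ∑ x ∈ s, f x / ((x - a) * ∏ y ∈ s.erase x, (x - y)) := by
    rw [Finset.mul_sum, ← Finset.sum_sub_distrib]
    refine Finset.sum_congr rfl fun x hx => ?_
    have hxa : x - a ≠ 0 := sub_ne_zero.2 fun h => ha (h ▸ hx)
    have hxb : x - b ≠ 0 := sub_ne_zero.2 fun h => hb (h ▸ hx)
    have hp : ∏ y ∈ s.erase x, (x - y) ≠ 0 :=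
      Finset.prod_ne_zero_iff.2 fun y hy => sub_ne_zero.2 (Finset.ne_of_mem_erase hy).symm
    rw [Finset.erase_insert_of_ne (sub_ne_zero.1 hxb).symm, Finset.prod_insert (by simp [hb])]
    field_simp
    ring
  have hpa : ∏ y ∈ s, (a - y) ≠ 0 :=
    Finset.prod_ne_zero_iff.2 fun y hy => sub_ne_zero.2 fun h => ha (h ▸ hy)
  have hpb : ∏ y ∈ s, (b - y) ≠ 0 :=
    Finset.prod_ne_zero_iff.2 fun y hy => sub_ne_zero.2 fun h => hb (h ▸ hy)
  rw [mul_add, mul_add, hsum]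
  have h1 : (b - a) * (f a / ((a - b) * ∏ y ∈ s, (a - y))) = -(f a / ∏ y ∈ s, (a - y)) := by
    field_simp
    ring
  have h2 : (b - a) * (f b / ((b - a) * ∏ y ∈ s, (b - y))) = f b / ∏ y ∈ s, (b - y) := by
    field_simp
  rw [h1, h2]
  ring

lemma divDiff_eval (P : Polynomial ℝ) {s : Finset ℝ} (h : P.natDegree < s.card) :
    divDiff (fun x => P.eval x) s = P.coeff (s.card - 1) := by
  have := Lagrange.coeff_eq_sum (F := ℝ) (s := s) (v := id) Function.injective_id.injOn
    (P := P) (P.degree_le_natDegree.trans_lt (by exact_mod_cast h))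
  simpa [divDiff] using this.symm

lemma divDiff_eval_eq_zero (P : Polynomial ℝ) {s : Finset ℝ} (h : P.natDegree + 1 < s.card) :
    divDiff (fun x => P.eval x) s = 0 := by
  rw [divDiff_eval P (by omega)]
  exact P.coeff_eq_zero_of_natDegree_lt (by omega)

/-- The `p + 1` points `x, x + 1, …, x + p`. -/
noncomputable def unitGrid (p : ℕ) (x : ℝ) : Finset ℝ :=
  (Finset.range (p + 1)).image fun i : ℕ => x + i

lemma mem_unitGrid {p : ℕ} {x y : ℝ} : y ∈ unitGrid p x ↔ ∃ i ≤ p, x + (i : ℕ) = y := by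
  simp [unitGrid]

lemma card_unitGrid (p : ℕ) (x : ℝ) : (unitGrid p x).card = p + 1 := by
  rw [unitGrid, Finset.card_image_of_injective _ fun i j h => by simpa using h,
    Finset.card_range]

lemma le_of_mem_unitGrid {p : ℕ} {x y : ℝ} (h : y ∈ unitGrid p x) : x ≤ y := by
  obtain ⟨i, -, rfl⟩ := mem_unitGrid.1 h
  simp

lemma le_add_of_mem_unitGrid {p : ℕ} {x y : ℝ} (h : y ∈ unitGrid p x) : y ≤ x + p := by
  obtain ⟨i, hi, rfl⟩ := mem_unitGrid.1 h
  have : (i : ℝ) ≤ p := by exact_mod_cast hi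
  linarith

lemma unitGrid_succ_right (p : ℕ) (x : ℝ) :
    unitGrid (p + 1) x = insert (x + (p + 1)) (unitGrid p x) := by
  rw [unitGrid, Finset.range_add_one, Finset.image_insert, unitGrid]
  simp

lemma unitGrid_succ_left (p : ℕ) (x : ℝ) :
    unitGrid (p + 1) x = insert x (unitGrid p (x + 1)) := by
  ext y
  rw [Finset.mem_insert, mem_unitGrid, mem_unitGrid]
  constructor
  · rintro ⟨i, hi, rfl⟩
    rcases i with _ | i
    · simp
    · right
      exact ⟨i, by omega, by push_cast; ring⟩
  · rintro (rfl | ⟨i, hi, rfl⟩)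
    · exact ⟨0, by omega, by simp⟩
    · exact ⟨i + 1, by omega, by push_cast; ring⟩

lemma divDiff_unitGrid (f : ℝ → ℝ) (p : ℕ) (x : ℝ) :
    divDiff f (unitGrid p x) = (fwdDiff (1 : ℝ))^[p] f x / p.factorial := by
  induction p generalizing x with
  | zero => simp [divDiff, unitGrid]
  | succ p ih =>
    have hx : x ∉ unitGrid p (x + 1) := fun h => by linarith [le_of_mem_unitGrid h]
    have key : divDiff f (unitGrid p (x + 1)) - divDiff f (unitGrid p x) =
        (p + 1) * divDiff f (unitGrid (p + 1) x) := by
      rcases p with _ | p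
      · have := divDiff_insert_sub f (a := x) (b := x + 1) (s := ∅) (by simp) (by simp)
          (by simp)
        have h2 : unitGrid (0 + 1) x = insert x (insert (x + 1) ∅) := by
          rw [unitGrid_succ_left]; simp [unitGrid]
        rw [h2]
        simpa [unitGrid] using this
      · have := divDiff_insert_sub f (a := x) (b := x + (p + 1 + 1)) (s := unitGrid p (x + 1))
          (fun h => by linarith [le_of_mem_unitGrid h])
          (fun h => by linarith [le_add_of_mem_unitGrid h]) (by linarith)
        rw [← unitGrid_succ_left] at this
        have h1 : insert (x + ((p : ℝ) + 1 + 1)) (unitGrid p (x + 1)) =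
            unitGrid (p + 1) (x + 1) := by
          rw [unitGrid_succ_right]; congr 1; ring
        rw [h1, ← unitGrid_succ_left] at this
        rw [this]; push_cast; ring
    rw [ih, ih, ← sub_div] at key
    rw [Function.iterate_succ_apply', fwdDiff, Nat.factorial_succ]
    have h3 : (p.factorial : ℝ) ≠ 0 := by exact_mod_cast p.factorial_ne_zero
    have h4 : (p : ℝ) + 1 ≠ 0 := by positivity
    push_cast
    field_simp
    field_simp at key
    linarith

/-! ### Convexity of higher order -/

lemma convexOfOrder_iff {p : ℕ} {I : Set ℝ} {f : ℝ → ℝ} :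
    ConvexOfOrder p I f ↔ ∀ s : Finset ℝ, ↑s ⊆ I → s.card = p + 2 → 0 ≤ divDiff f s := by
  constructor
  · intro h s hs hc
    have := h (s.orderEmbOfFin hc) (s.orderEmbOfFin hc).strictMono
      fun i => hs (s.orderEmbOfFin_mem hc i)
    rwa [dividedDiff_eq_divDiff _ (s.orderEmbOfFin hc).injective,
      Finset.image_orderEmbOfFin_univ] at this
  · intro h x hx hI
    rw [dividedDiff_eq_divDiff _ hx.injective]
    refine h _ ?_ ?_
    · intro y hy
      simp only [Finset.coe_image, Finset.coe_univ, image_univ, mem_range] at hy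
      obtain ⟨i, rfl⟩ := hy
      exact hI i
    · rw [Finset.card_image_of_injective _ hx.injective, Finset.card_univ, Fintype.card_fin]

lemma concaveOfOrder_iff_neg {p : ℕ} {I : Set ℝ} {f : ℝ → ℝ} :
    ConcaveOfOrder p I f ↔ ConvexOfOrder p I (-f) := by
  refine forall_congr' fun x => forall_congr' fun hx => forall_congr' fun _ => ?_
  rw [dividedDiff_eq_divDiff _ hx.injective, dividedDiff_eq_divDiff _ hx.injective, divDiff_neg,
    neg_nonneg]

/-- The divided differences of a `p`-convex function at `p + 1` points are nondecreasing in the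
points. The set `U` collects the points that stay, and the others move from `u i` up to `v i`, one
after the other; the new positions have to differ from the old ones. -/
lemma ConvexOfOrder.divDiff_image_union_le {p : ℕ} {I : Set ℝ} {f : ℝ → ℝ}
    (hf : ConvexOfOrder p I f) {ι : Type*} (t : Finset ι) {u v : ι → ℝ} (U : Finset ℝ)
    (hu : InjOn u t) (hv : InjOn v t) (huv : ∀ i ∈ t, ∀ j ∈ t, u i ≠ v j)
    (hlt : ∀ i ∈ t, u i < v i) (huU : ∀ i ∈ t, u i ∉ U) (hvU : ∀ i ∈ t, v i ∉ U)
    (huI : ∀ i ∈ t, u i ∈ I) (hvI : ∀ i ∈ t, v i ∈ I) (hUI : ↑U ⊆ I)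
    (hcard : t.card + U.card = p + 1) :
    divDiff f (t.image u ∪ U) ≤ divDiff f (t.image v ∪ U) := by
  classical
  induction t using Finset.induction_on generalizing U with
  | empty => simp
  | insert a t ha ih =>
    rw [Finset.card_insert_of_notMem ha] at hcard
    simp only [Finset.mem_insert, forall_eq_or_imp] at huv hlt huU hvU huI hvI
    have hua : u a ∉ t.image u := by
      intro h
      obtain ⟨i, hi, hia⟩ := Finset.mem_image.1 h
      have := hu (by simp [hi]) (by simp) hia
      exact ha (this ▸ hi)
    have hva : v a ∉ t.image u := by
      intro h
      obtain ⟨i, hi, hia⟩ := Finset.mem_image.1 h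
      exact (huv.2 i hi).1 hia
    have hva' : ∀ i ∈ t, v i ≠ v a := by
      intro i hi h
      have := hv (by simp [hi]) (by simp) h
      exact ha (this ▸ hi)
    have hdisj : Disjoint (t.image u) U := by
      rw [Finset.disjoint_left]
      intro x hx
      obtain ⟨i, hi, rfl⟩ := Finset.mem_image.1 hx
      exact huU.2 i hi
    have hu' : InjOn u t := hu.mono (by simp)
    -- move the point `u a` to `v a`
    have h1 : divDiff f ((insert a t).image u ∪ U) ≤ divDiff f (t.image u ∪ insert (v a) U) := by
      rw [Finset.image_insert, Finset.insert_union, Finset.union_insert, ← sub_nonneg,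
        divDiff_insert_sub f (by simpa using ⟨by simpa using hua, huU.1⟩)
          (by simpa using ⟨by simpa using hva, hvU.1⟩) huv.1.1]
      refine mul_nonneg (sub_nonneg.2 hlt.1.le) (convexOfOrder_iff.1 hf _ ?_ ?_)
      · intro x hx
        simp only [Finset.coe_insert, Finset.coe_union, Finset.coe_image, mem_insert_iff,
          mem_union, mem_image, Finset.mem_coe] at hx
        rcases hx with rfl | rfl | ⟨i, hi, rfl⟩ | hx
        exacts [huI.1, hvI.1, huI.2 i hi, hUI hx]
      · rw [Finset.card_insert_of_notMem, Finset.card_insert_of_notMem,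
          Finset.card_union_of_disjoint hdisj, Finset.card_image_of_injOn hu']
        · omega
        · simpa using ⟨by simpa using hva, hvU.1⟩
        · simpa using ⟨huv.1.1, by simpa using hua, huU.1⟩
    refine h1.trans ?_
    have h2 := ih (insert (v a) U) hu' (hv.mono (by simp)) (fun i hi j hj => (huv.2 i hi).2 j hj)
      hlt.2 (fun i hi => by simpa using ⟨(huv.2 i hi).1, huU.2 i hi⟩)
      (fun i hi => by simpa using ⟨hva' i hi, hvU.2 i hi⟩) huI.2 hvI.2
      (by simpa [insert_subset_iff] using ⟨hvI.1, hUI⟩)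
      (by rw [Finset.card_insert_of_notMem hvU.1]; omega)
    refine h2.trans (le_of_eq ?_)
    rw [Finset.image_insert, Finset.insert_union, Finset.union_insert]

/-- The form of monotonicity in which every point of `s` lies to the left of every point of `t`. -/
lemma ConvexOfOrder.divDiff_le_of_lt {p : ℕ} {I : Set ℝ} {f : ℝ → ℝ}
    (hf : ConvexOfOrder p I f) {s t : Finset ℝ} (hs : s.card = p + 1) (ht : t.card = p + 1)
    (hsI : ↑s ⊆ I) (htI : ↑t ⊆ I) (hlt : ∀ x ∈ s, ∀ y ∈ t, x < y) :
    divDiff f s ≤ divDiff f t := by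
  have hlt' : ∀ i j, s.orderEmbOfFin hs i < t.orderEmbOfFin ht j := fun i j =>
    hlt _ (s.orderEmbOfFin_mem hs i) _ (t.orderEmbOfFin_mem ht j)
  have := hf.divDiff_image_union_le (Finset.univ : Finset (Fin (p + 1)))
    (u := s.orderEmbOfFin hs) (v := t.orderEmbOfFin ht) ∅
    (s.orderEmbOfFin hs).injective.injOn (t.orderEmbOfFin ht).injective.injOn
    (fun i _ j _ => (hlt' i j).ne) (fun i _ => hlt' i i) (by simp) (by simp)
    (fun i _ => hsI (s.orderEmbOfFin_mem hs i)) (fun i _ => htI (t.orderEmbOfFin_mem ht i))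
    (by simp) (by simp)
  simpa only [Finset.image_orderEmbOfFin_univ, Finset.union_empty] using this

lemma neg_mem_KPlus {p : ℕ} {f : ℝ → ℝ} (h : f ∈ KMinus p) : -f ∈ KPlus p := by
  obtain ⟨a, ha, h⟩ := h
  exact ⟨a, ha, concaveOfOrder_iff_neg.1 h⟩

/-- The divided differences of a `(p + 1)`-convex function at `p + 2` points increase with the
points. Hence either none of them is positive, or those far enough to the right are all
nonnegative. -/
lemma KPlus_succ_subset (p : ℕ) : KPlus (p + 1) ⊆ K p := by
  rintro f ⟨a, ha, hf⟩
  by_cases h : ∀ s : Finset ℝ, ↑s ⊆ Ici a → s.card = p + 2 → divDiff f s ≤ 0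
  · refine Or.inr ⟨a, ha, concaveOfOrder_iff_neg.2 (convexOfOrder_iff.2 fun s hs hc => ?_)⟩
    rw [divDiff_neg]
    exact neg_nonneg.2 (h s hs hc)
  · push Not at h
    obtain ⟨s, hs, hc, hpos⟩ := h
    obtain ⟨b, hb⟩ := s.bddAbove
    refine Or.inl ⟨max a (b + 1), lt_max_of_lt_left ha, convexOfOrder_iff.2 fun t ht htc => ?_⟩
    refine hpos.le.trans (hf.divDiff_le_of_lt hc htc hs (fun x hx => ?_) fun x hx y hy => ?_)
    · exact (le_max_left a (b + 1)).trans (mem_Ici.1 (ht hx))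
    · have := (le_max_right a (b + 1)).trans (mem_Ici.1 (ht hy))
      have := hb hx
      linarith

lemma neg_mem_K {p : ℕ} {f : ℝ → ℝ} (h : f ∈ K p) : -f ∈ K p := by
  rcases h with ⟨a, ha, h⟩ | h
  · exact Or.inr ⟨a, ha, concaveOfOrder_iff_neg.2 (by rwa [neg_neg])⟩
  · exact Or.inl (neg_mem_KPlus h)

lemma K_succ_subset (p : ℕ) : K (p + 1) ⊆ K p := by
  rintro f (h | h)
  · exact KPlus_succ_subset p h
  · simpa using neg_mem_K (KPlus_succ_subset p (neg_mem_KPlus h))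

lemma K_antitone : Antitone K := antitone_nat_of_succ_le K_succ_subset

/-- The derivative of a `(q + 1)`-convex function is `q`-convex: a divided difference of `f'` is the
limit as `h → 0⁺` of the differences `(f[x + h] - f[x]) / h`, which are nonnegative. -/
lemma convexOfOrder_deriv {q : ℕ} {a : ℝ} {f : ℝ → ℝ} (hf : ConvexOfOrder (q + 1) (Ici a) f)
    (hd : ∀ x ∈ Ici a, DifferentiableAt ℝ f x) : ConvexOfOrder q (Ici a) (deriv f) := by
  rw [convexOfOrder_iff]
  intro s hs hc
  have hlim : Tendsto (fun h : ℝ => divDiff (fun x => (f (x + h) - f x) / h) s) (𝓝[>] 0)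
      (𝓝 (divDiff (deriv f) s)) := by
    refine tendsto_divDiff fun x hx => ?_
    have := (hd x (hs hx)).hasDerivAt.tendsto_slope_zero_right
    refine this.congr fun h => ?_
    rw [smul_eq_mul, inv_mul_eq_div]
  -- for small `h` the points `x + h` are no points of `s`
  have hsmall : ∀ᶠ h in 𝓝[>] (0 : ℝ), ∀ x ∈ s, ∀ y ∈ s, x ≠ y + h := by
    rw [Finset.eventually_all]
    intro x _
    rw [Finset.eventually_all]
    intro y _
    by_cases hxy : x = y
    · filter_upwards [self_mem_nhdsWithin] with h (hh : 0 < h)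
      rw [hxy]; linarith
    · have : ∀ᶠ h in 𝓝 (0 : ℝ), h ≠ x - y :=
        eventually_ne_nhds (sub_ne_zero.2 hxy).symm
      filter_upwards [nhdsWithin_le_nhds this] with h hh h'
      exact hh (by linarith)
  refine ge_of_tendsto hlim ?_
  filter_upwards [self_mem_nhdsWithin, hsmall] with h (hh : 0 < h) hne
  rw [divDiff_div_const, divDiff_sub, divDiff_comp_add_right]
  refine div_nonneg (sub_nonneg.2 ?_) hh.le
  have := hf.divDiff_image_union_le s (u := id) (v := (· + h)) ∅ Function.injective_id.injOn
    (add_left_injective h).injOn hne (fun x _ => by simpa using hh) (by simp) (by simp)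
    (fun x hx => hs hx) (fun x hx => by
      have : a ≤ x := hs hx
      simp only [mem_Ici]
      linarith) (by simp) (by simpa using hc)
  simpa using this

lemma differentiableAt_iteratedDeriv {f : ℝ → ℝ} {r n : ℕ} {x : ℝ} (h : ContDiffAt ℝ n f x)
    (hrn : r < n) : DifferentiableAt ℝ (iteratedDeriv r f) x := by
  have := (h.contDiffWithinAt (s := univ)).differentiableWithinAt_iteratedDerivWithin (m := r)
    (by exact_mod_cast hrn) (by simp)
  simpa only [iteratedDerivWithin_univ, differentiableWithinAt_univ] using this

lemma convexOfOrder_iteratedDeriv {q r : ℕ} {a : ℝ} {f : ℝ → ℝ}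
    (hf : ConvexOfOrder (q + r) (Ici a) f) (ha : 0 < a) (hC : ContDiffOn ℝ r f (Ioi 0)) :
    ConvexOfOrder q (Ici a) (iteratedDeriv r f) := by
  induction r generalizing q with
  | zero => simpa using hf
  | succ r ih =>
    rw [iteratedDeriv_succ]
    refine convexOfOrder_deriv (ih (by rwa [add_right_comm]) (hC.of_le ?_)) fun x hx => ?_
    · exact_mod_cast Nat.le_succ r
    · exact differentiableAt_iteratedDeriv (hC.contDiffAt (Ioi_mem_nhds (ha.trans_le hx)))
        (Nat.lt_succ_self r)

/-! ### Newton interpolation and the increments of `fSeq` -/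

/-- The binomial coefficient `(x choose j)` as a polynomial in `x`. -/
noncomputable def binomPoly (j : ℕ) : Polynomial ℝ :=
  Polynomial.C (j.factorial : ℝ)⁻¹ * descPochhammer ℝ j

lemma eval_binomPoly (j : ℕ) (x : ℝ) : (binomPoly j).eval x = Ring.choose x j := by
  rw [Ring.choose_eq_smul, binomPoly, Polynomial.eval_mul, Polynomial.eval_C, smul_eq_mul,
    ← descPochhammer_map (Int.castRingHom ℝ), Polynomial.eval_map,
    ← Polynomial.eval₂_smulOneHom_eq_smeval]
  congr 2
  exact Subsingleton.elim _ _

lemma natDegree_binomPoly_le (j : ℕ) : (binomPoly j).natDegree ≤ j :=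
  (Polynomial.natDegree_C_mul_le _ _).trans (descPochhammer_natDegree ℝ j).le

/-- The polynomial in `x` of degree at most `m` that takes the values `g (a + x)` at
`x = 0, 1, …, m`, in Newton's form. -/
noncomputable def newtonPoly (g : ℝ → ℝ) (m : ℕ) (a : ℝ) : Polynomial ℝ :=
  ∑ j ∈ Finset.range (m + 1), Polynomial.C ((fwdDiff (1 : ℝ))^[j] g a) * binomPoly j

lemma natDegree_newtonPoly_le (g : ℝ → ℝ) (m : ℕ) (a : ℝ) : (newtonPoly g m a).natDegree ≤ m :=
  Polynomial.natDegree_sum_le_of_forall_le _ _ fun j hj =>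
    ((Polynomial.natDegree_C_mul_le _ _).trans (natDegree_binomPoly_le j)).trans
      (Nat.lt_succ_iff.1 (Finset.mem_range.1 hj))

lemma eval_newtonPoly (g : ℝ → ℝ) (m : ℕ) (a x : ℝ) :
    (newtonPoly g m a).eval x =
      ∑ j ∈ Finset.range (m + 1), (fwdDiff (1 : ℝ))^[j] g a * Ring.choose x j := by
  simp [newtonPoly, Polynomial.eval_finsetSum, eval_binomPoly]

lemma eval_newtonPoly_natCast (g : ℝ → ℝ) {m k : ℕ} (hk : k ≤ m) (a : ℝ) :
    (newtonPoly g m a).eval (k : ℝ) = g (k + a) := by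
  have := shift_eq_sum_fwdDiff_iter (1 : ℝ) g k a
  rw [nsmul_eq_mul, mul_one, add_comm] at this
  rw [this, eval_newtonPoly]
  symm
  refine Finset.sum_subset_zero_on_sdiff (Finset.range_subset_range.2 (by omega)) ?_ ?_
  · intro j hj
    have : k < j := by simpa using (Finset.mem_sdiff.1 hj).2
    rw [Ring.choose_natCast, Nat.choose_eq_zero_of_lt this]
    simp
  · intro j _
    rw [Ring.choose_natCast, nsmul_eq_mul, mul_comm]

/-- The leading coefficient is the divided difference at the interpolation points. -/
lemma coeff_newtonPoly (g : ℝ → ℝ) (m : ℕ) (a : ℝ) :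
    (newtonPoly g m a).coeff m = (fwdDiff (1 : ℝ))^[m] g a / m.factorial := by
  have h := divDiff_eval (newtonPoly g m a) (s := unitGrid m 0)
    (by rw [card_unitGrid]; exact Nat.lt_succ_of_le (natDegree_newtonPoly_le g m a))
  rw [card_unitGrid, Nat.add_sub_cancel] at h
  rw [← h, ← divDiff_unitGrid, divDiff_congr (g := fun x => g (x + a)), divDiff_comp_add_right]
  · congr 1
    rw [unitGrid, unitGrid, Finset.image_image]
    exact Finset.image_congr fun i _ => by simp [add_comm]
  · intro x hx
    obtain ⟨i, hi, rfl⟩ := mem_unitGrid.1 hx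
    rw [zero_add, eval_newtonPoly_natCast g hi]

lemma fSeq_succ_sub (p : ℕ) {n : ℕ} (hn : 1 ≤ n) (g : ℝ → ℝ) (x : ℝ) :
    fSeq p (n + 1) g x - fSeq p n g x = -(g (x + n) - (newtonPoly g p n).eval x) := by
  obtain ⟨n, rfl⟩ := Nat.exists_eq_add_of_le' hn
  have h1 : ∑ k ∈ Finset.Icc 1 (n + 1), (g k - g (x + k)) =
      ∑ k ∈ Finset.Icc 1 n, (g k - g (x + k)) + (g ↑(n + 1) - g (x + ↑(n + 1))) :=
    Finset.sum_Icc_succ_top (by omega) _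
  have h2 : ∀ a : ℝ, ∀ j ∈ Finset.Icc 1 p, (fwdDiff (1 : ℝ))^[j] g a =
      (fwdDiff (1 : ℝ))^[j - 1] g (a + 1) - (fwdDiff (1 : ℝ))^[j - 1] g a := by
    intro a j hj
    obtain ⟨i, rfl⟩ := Nat.exists_eq_add_of_le' (Finset.mem_Icc.1 hj).1
    rw [Function.iterate_succ_apply', fwdDiff, Nat.add_sub_cancel]
  have h3 : (newtonPoly g p ↑(n + 1)).eval x = g ↑(n + 1) +
      ∑ j ∈ Finset.Icc 1 p, Ring.choose x j * ((fwdDiff (1 : ℝ))^[j - 1] g (↑(n + 1) + 1) -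
        (fwdDiff (1 : ℝ))^[j - 1] g ↑(n + 1)) := by
    rw [eval_newtonPoly, Finset.range_eq_Ico, Finset.sum_eq_sum_Ico_succ_bot (by omega)]
    simp only [Function.iterate_zero, id_eq, Ring.choose_zero_right, mul_one]
    congr 1
    refine Finset.sum_congr (by ext; simp) fun j hj => ?_
    rw [h2 _ j (by simpa [Nat.lt_succ_iff] using hj), mul_comm]
  simp only [fSeq, Nat.add_sub_cancel]
  rw [h1, h3]
  simp only [mul_sub, Finset.sum_sub_distrib]
  push_cast
  ring

/-! ### Bounding the increments and their derivatives -/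

/-- Rolle's theorem for finitely many zeros. -/
lemma exists_finset_deriv_eq_zero {f : ℝ → ℝ} {A B : ℝ}
    (hd : ∀ x ∈ Icc A B, DifferentiableAt ℝ f x) {k : ℕ} {s : Finset ℝ} (hs : ↑s ⊆ Icc A B)
    (hc : s.card = k + 1) (hz : ∀ x ∈ s, f x = 0) :
    ∃ t : Finset ℝ, ↑t ⊆ Icc A B ∧ t.card = k ∧ ∀ x ∈ t, deriv f x = 0 := by
  set e := s.orderEmbOfFin hc with he
  have hmem : ∀ i, e i ∈ s := s.orderEmbOfFin_mem hc
  have hex : ∀ i : Fin k, ∃ c ∈ Ioo (e i.castSucc) (e i.succ), deriv f c = 0 := fun i =>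
    exists_deriv_eq_zero (e.strictMono i.castSucc_lt_succ)
      (fun x hx => (hd x ⟨(hs (hmem _)).1.trans hx.1, hx.2.trans (hs (hmem _)).2⟩).continuousAt
        |>.continuousWithinAt) (by rw [hz _ (hmem _), hz _ (hmem _)])
  choose ξ hξ hξ' using hex
  have hmono : StrictMono ξ := by
    intro i j hij
    have : e i.succ ≤ e j.castSucc := e.monotone (by simpa [Fin.le_def] using hij)
    exact (hξ i).2.trans_le (this.trans (hξ j).1.le)
  refine ⟨Finset.univ.image ξ, ?_, ?_, ?_⟩
  · intro x hx
    simp only [Finset.coe_image, Finset.coe_univ, image_univ, mem_range] at hx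
    obtain ⟨i, rfl⟩ := hx
    exact ⟨(hs (hmem _)).1.trans (hξ i).1.le, (hξ i).2.le.trans (hs (hmem _)).2⟩
  · rw [Finset.card_image_of_injective _ hmono.injective, Finset.card_univ, Fintype.card_fin]
  · simpa using hξ'

lemma exists_finset_iteratedDeriv_eq_zero {f : ℝ → ℝ} {A B : ℝ} {r : ℕ}
    (hd : ∀ x ∈ Icc A B, ContDiffAt ℝ r f x) {k : ℕ} {s : Finset ℝ} (hs : ↑s ⊆ Icc A B)
    (hc : s.card = k + r) (hz : ∀ x ∈ s, f x = 0) :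
    ∃ t : Finset ℝ, ↑t ⊆ Icc A B ∧ t.card = k ∧ ∀ x ∈ t, iteratedDeriv r f x = 0 := by
  induction r generalizing k with
  | zero => exact ⟨s, hs, hc, by simpa using hz⟩
  | succ r ih =>
    obtain ⟨t, ht, htc, htz⟩ := ih
      (fun x hx => (hd x hx).of_le (by exact_mod_cast Nat.le_succ r)) (k := k + 1) (by omega)
    rw [iteratedDeriv_succ]
    exact exists_finset_deriv_eq_zero
      (fun x hx => differentiableAt_iteratedDeriv (hd x hx) (Nat.lt_succ_self r)) ht htc htz

lemma iteratedDeriv_eval (P : Polynomial ℝ) (r : ℕ) :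
    iteratedDeriv r (fun x => P.eval x) = fun x => (Polynomial.derivative^[r] P).eval x := by
  induction r with
  | zero => simp
  | succ r ih =>
    rw [iteratedDeriv_succ, ih, Function.iterate_succ_apply']
    ext x
    exact Polynomial.deriv _

lemma contDiffAt_comp_add {g : ℝ → ℝ} {r : ℕ} (hC : g ∈ C r) {x c : ℝ} (h : 0 < x + c) :
    ContDiffAt ℝ r (fun y => g (y + c)) x :=
  ContDiffAt.comp x (g := g) (f := fun y => y + c) (ContDiffOn.contDiffAt hC (Ioi_mem_nhds h))
    (by fun_prop)

lemma contDiffAt_eval (P : Polynomial ℝ) (r : ℕ) (x : ℝ) :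
    ContDiffAt ℝ r (fun y => P.eval y) x := by
  simpa using (Polynomial.contDiff_aeval (𝕜 := ℝ) P r).contDiffAt

lemma iteratedDeriv_comp_add_sub_eval {g : ℝ → ℝ} {r : ℕ} (hC : g ∈ C r) (P : Polynomial ℝ)
    {x c : ℝ} (h : 0 < x + c) :
    iteratedDeriv r (fun y => g (y + c) - P.eval y) x =
      iteratedDeriv r g (x + c) - (Polynomial.derivative^[r] P).eval x := by
  have := iteratedDeriv_sub (contDiffAt_comp_add hC h) (contDiffAt_eval P r x)
  rw [iteratedDeriv_eval, iteratedDeriv_comp_add_const] at this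
  exact this

/-- The bound on the `r`-th derivative of the error of Newton interpolation at `n, …, n + q + r`.
That derivative is the error of the interpolation of `D^r g` at `q + 1` points provided by Rolle's
theorem, so it is a product of `q` distances and a difference of two divided differences of
`D^r g`. By monotonicity the latter lie between the divided differences on a grid far enough to
the left and on a grid far enough to the right. -/
lemma abs_iteratedDeriv_interpolation_error_le {g : ℝ → ℝ} {q r n N : ℕ} {a : ℝ} (ha : 0 < a)
    (hC : g ∈ C r) (hconv : ConvexOfOrder q (Ici a) (iteratedDeriv r g))
    (hn : a + (q + 1) ≤ n) (hN : q + r < N) :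
    (∀ x : ℝ, 0 < x → x < N →
      |iteratedDeriv r (fun y => g (y + n) - (newtonPoly g (q + r) n).eval y) x| ≤
        N ^ q * (divDiff (iteratedDeriv r g) (unitGrid q (n + N)) -
          divDiff (iteratedDeriv r g) (unitGrid q (n - (q + 1))))) ∧
    divDiff (iteratedDeriv r g) (unitGrid q (n - (q + 1))) ≤
      divDiff (iteratedDeriv r g) (unitGrid q (n + N)) ∧
    divDiff (iteratedDeriv r g) (unitGrid q (n - (q + 1))) ≤
      (q + r).descFactorial r * ((fwdDiff (1 : ℝ))^[q + r] g n / (q + r).factorial) := by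
  set h := iteratedDeriv r g with hh
  set P := newtonPoly g (q + r) n with hP
  set R := Polynomial.derivative^[r] P with hR
  set D := iteratedDeriv r (fun y => g (y + n) - P.eval y) with hD
  have hn0 : 0 < (n : ℝ) := by
    have : (0 : ℝ) ≤ q := q.cast_nonneg
    linarith
  have hNq : (q : ℝ) + r < N := by exact_mod_cast hN
  have hr0 : (0 : ℝ) ≤ r := r.cast_nonneg
  have hq0 : (0 : ℝ) ≤ q := q.cast_nonneg
  have hDx : ∀ x : ℝ, 0 ≤ x → D x = h (x + n) - R.eval x := fun x hx =>
    iteratedDeriv_comp_add_sub_eval hC P (by linarith)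
  have hRdeg : R.natDegree ≤ q :=
    (Polynomial.natDegree_iterate_derivative P r).trans
      (Nat.sub_le_of_le_add (natDegree_newtonPoly_le g (q + r) n))
  have hRcoeff : R.coeff q =
      (q + r).descFactorial r * ((fwdDiff (1 : ℝ))^[q + r] g n / (q + r).factorial) := by
    rw [hR, Polynomial.coeff_iterate_derivative, hP, coeff_newtonPoly, nsmul_eq_mul]
  -- comparison of the divided differences of `h`
  have hgridI : ∀ y : ℝ, a ≤ y → (↑(unitGrid q y) : Set ℝ) ⊆ Ici a := fun y hy z hz =>
    hy.trans (le_of_mem_unitGrid hz)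
  have hcmp : ∀ s : Finset ℝ, s.card = q + 1 → (∀ x ∈ s, 0 ≤ x ∧ x < N) →
      divDiff h (unitGrid q (n - (q + 1))) ≤ divDiff (fun x => h (x + n)) s ∧
      divDiff (fun x => h (x + n)) s ≤ divDiff h (unitGrid q (n + N)) := by
    intro s hs hsN
    rw [divDiff_comp_add_right]
    have hcard : (s.image (· + (n : ℝ))).card = q + 1 := by
      rw [Finset.card_image_of_injective _ (add_left_injective _), hs]
    have hsI : (↑(s.image (· + (n : ℝ))) : Set ℝ) ⊆ Ici a := by
      intro z hz
      simp only [Finset.coe_image, mem_image, Finset.mem_coe] at hz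
      obtain ⟨x, hx, rfl⟩ := hz
      have := (hsN x hx).1
      simp only [mem_Ici]
      linarith
    constructor
    · refine hconv.divDiff_le_of_lt (card_unitGrid _ _) hcard (hgridI _ (by linarith)) hsI ?_
      intro z hz y hy
      obtain ⟨x, hx, rfl⟩ := Finset.mem_image.1 hy
      have := le_add_of_mem_unitGrid hz
      have := (hsN x hx).1
      linarith
    · refine hconv.divDiff_le_of_lt hcard (card_unitGrid _ _) hsI (hgridI _ (by linarith)) ?_
      intro y hy z hz
      obtain ⟨x, hx, rfl⟩ := Finset.mem_image.1 hy
      have := le_of_mem_unitGrid hz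
      have := (hsN x hx).2
      linarith
  -- zeros of `D`
  obtain ⟨t, htI, htc, htz⟩ : ∃ t : Finset ℝ, ↑t ⊆ Icc (0 : ℝ) ((q : ℝ) + r) ∧ t.card = q + 1 ∧
      ∀ x ∈ t, D x = 0 := by
    refine exists_finset_iteratedDeriv_eq_zero (s := unitGrid (q + r) 0)
      (fun x hx => (contDiffAt_comp_add hC (by have := hx.1; linarith)).sub
        (contDiffAt_eval P r x)) ?_ (by rw [card_unitGrid]; omega) ?_
    · intro x hx
      have := le_add_of_mem_unitGrid hx
      push_cast at this
      exact ⟨le_of_mem_unitGrid hx, by linarith⟩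
    · intro x hx
      obtain ⟨i, hi, rfl⟩ := mem_unitGrid.1 hx
      rw [zero_add, hP, eval_newtonPoly_natCast g hi, sub_self]
  have htN : ∀ x ∈ t, 0 ≤ x ∧ x < N := fun x hx => ⟨(htI hx).1, (htI hx).2.trans_lt hNq⟩
  have hDs : ∀ s : Finset ℝ, (∀ x ∈ s, 0 ≤ x) →
      divDiff D s = divDiff (fun x => h (x + n)) s - divDiff (fun x => R.eval x) s := by
    intro s hs
    rw [← divDiff_sub]
    exact divDiff_congr fun x hx => hDx x (hs x hx)
  have ht : divDiff (fun x => h (x + n)) t = R.coeff q := by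
    have h1 : divDiff D t = 0 := Finset.sum_eq_zero fun x hx => by rw [htz x hx, zero_div]
    rw [hDs t fun x hx => (htN x hx).1, divDiff_eval R (by omega), htc] at h1
    simpa using sub_eq_zero.1 h1
  have hle := hcmp t htc htN
  refine ⟨fun x hx hxN => ?_, hle.1.trans hle.2, (hle.1.trans_eq ht).trans_eq hRcoeff⟩
  have hdiff : 0 ≤ divDiff h (unitGrid q (n + N)) - divDiff h (unitGrid q (n - (q + 1))) :=
    sub_nonneg.2 (hle.1.trans hle.2)
  -- Outside `t`, the value `D x` is read off from the divided difference of `D` at `x` and the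
  -- points of `t`, to which `R` does not contribute since its degree is at most `q`.
  by_cases hxt : x ∈ t
  · rw [htz x hxt, abs_zero]
    positivity
  have hpos : ∀ y ∈ insert x t, 0 ≤ y ∧ y < N := by
    simpa using ⟨⟨hx.le, hxN⟩, htN⟩
  have hDprod : D x = (∏ y ∈ t, (x - y)) * divDiff (fun x => h (x + n)) (insert x t) := by
    have hne : ∏ y ∈ t, (x - y) ≠ 0 :=
      Finset.prod_ne_zero_iff.2 fun y hy => sub_ne_zero.2 fun hxy => hxt (hxy ▸ hy)
    have h1 := hDs (insert x t) fun y hy => (hpos y hy).1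
    rw [divDiff_eval_eq_zero R (by rw [Finset.card_insert_of_notMem hxt]; omega), sub_zero,
      divDiff_insert D hxt, Finset.sum_eq_zero fun y hy => by rw [htz y hy, zero_div],
      add_zero] at h1
    rw [← h1]
    field_simp
  obtain ⟨ξ, hξ⟩ : t.Nonempty := Finset.card_pos.1 (by omega)
  have hxξ : x ≠ ξ := fun hxy => hxt (hxy ▸ hξ)
  have hstep := divDiff_insert_sub (fun x => h (x + n)) (a := ξ) (b := x) (s := t.erase ξ)
    (Finset.notMem_erase _ _) (fun hx' => hxt (Finset.mem_of_mem_erase hx')) hxξ.symm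
  rw [Finset.insert_comm, Finset.insert_erase hξ] at hstep
  rw [← Finset.mul_prod_erase t _ hξ, mul_comm (x - ξ), mul_assoc, ← hstep] at hDprod
  rw [hDprod, abs_mul]
  refine mul_le_mul ?_ ?_ (abs_nonneg _) (by positivity)
  · rw [Finset.abs_prod]
    refine (Finset.prod_le_prod (g := fun _ => (N : ℝ)) (fun _ _ => abs_nonneg _)
      fun y hy => ?_).trans_eq ?_
    · have := htN y (Finset.mem_of_mem_erase hy)
      rw [abs_le]
      constructor <;> linarith
    · rw [Finset.prod_const, Finset.card_erase_of_mem hξ, htc, Nat.add_sub_cancel]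
  · have h1 := hcmp (insert x (t.erase ξ))
      (by rw [Finset.card_insert_of_notMem fun hx' => hxt (Finset.mem_of_mem_erase hx'),
        Finset.card_erase_of_mem hξ, htc, Nat.add_sub_cancel])
      (fun y hy => hpos y (Finset.insert_subset_insert _ (Finset.erase_subset _ _) hy))
    rw [abs_le]
    constructor <;> linarith [h1.1, h1.2, hle.1, hle.2]

/-- The partial sums telescope to at most the sum of `c - S i` over `L` consecutive indices `i`. -/
lemma summable_shift_sub {S : ℕ → ℝ} {L : ℕ} {c : ℝ} (hc : ∀ᶠ n in atTop, S n ≤ c)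
    (hm : ∀ᶠ n in atTop, S n ≤ S (n + L)) : Summable fun n => S (n + L) - S n := by
  obtain ⟨n₀, hn₀⟩ := eventually_atTop.1 (hc.and hm)
  rw [← summable_nat_add_iff n₀]
  refine summable_of_sum_range_le (c := ∑ i ∈ Finset.range L, (c - S (0 + i + n₀)))
    (fun n => sub_nonneg.2 (hn₀ _ (by omega)).2) fun n => ?_
  have htel : ∀ n, S (n + n₀ + L) - S (n + n₀) =
      ∑ i ∈ Finset.range L, S (n + 1 + i + n₀) - ∑ i ∈ Finset.range L, S (n + i + n₀) := by
    intro n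
    have h1 := Finset.sum_range_succ (fun i => S (n + i + n₀)) L
    rw [Finset.sum_range_succ'] at h1
    have h2 : ∀ i, n + (i + 1) + n₀ = n + 1 + i + n₀ := fun i => by omega
    simp only [h2] at h1
    rw [show n + n₀ + L = n + L + n₀ by omega]
    simp only [add_zero] at h1
    linarith
  simp only [htel]
  rw [Finset.sum_range_sub (fun n => ∑ i ∈ Finset.range L, S (n + i + n₀)),
    ← Finset.sum_sub_distrib]
  exact Finset.sum_le_sum fun i _ => sub_le_sub_right (hn₀ _ (by omega)).1 _

/-! ### Elementary properties of `fSeq` -/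

lemma contDiffAt_fSeq {g : ℝ → ℝ} {r : ℕ} (hC : g ∈ C r) (p n : ℕ) {x : ℝ} (hx : 0 < x) :
    ContDiffAt ℝ r (fSeq p n g) x := by
  have h0 : ContDiffAt ℝ r g x := ContDiffOn.contDiffAt hC (Ioi_mem_nhds hx)
  refine (h0.neg.add (ContDiffAt.sum fun k _ => ?_)).add (ContDiffAt.sum fun j _ => ?_)
  · exact contDiffAt_const.sub (contDiffAt_comp_add hC (by positivity))
  · simp only [← eval_binomPoly]
    exact (contDiffAt_eval _ r x).mul contDiffAt_const

lemma fwdDiff_iter_neg (g : ℝ → ℝ) (j : ℕ) :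
    (fwdDiff (1 : ℝ))^[j] (-g) = -(fwdDiff (1 : ℝ))^[j] g := by
  have := fwdDiff_iter_const_smul (h := (1 : ℝ)) (-1 : ℝ) g j
  simpa only [neg_one_smul] using this

lemma fSeq_neg (p n : ℕ) (g : ℝ → ℝ) : fSeq p n (-g) = -fSeq p n g := by
  ext x
  simp only [fSeq, fwdDiff_iter_neg, Pi.neg_apply, mul_neg, Finset.sum_neg_distrib,
    Finset.sum_sub_distrib]
  ring

lemma fSeq_succ_left (p n : ℕ) (g : ℝ → ℝ) (x : ℝ) :
    fSeq (p + 1) n g x =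
      fSeq p n g x + (fwdDiff (1 : ℝ))^[p] g n * (binomPoly (p + 1)).eval x := by
  rw [fSeq, Finset.sum_Icc_succ_top (by omega), Nat.add_sub_cancel, eval_binomPoly, fSeq]
  ring

lemma iteratedDeriv_fSeq_succ_left {g : ℝ → ℝ} {r : ℕ} (hC : g ∈ C r) (p n : ℕ) {x : ℝ}
    (hx : 0 < x) :
    iteratedDeriv r (fSeq (p + 1) n g) x = iteratedDeriv r (fSeq p n g) x +
      (fwdDiff (1 : ℝ))^[p] g n * (Polynomial.derivative^[r] (binomPoly (p + 1))).eval x := by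
  have h : fSeq (p + 1) n g = fSeq p n g +
      fun x => (Polynomial.C ((fwdDiff (1 : ℝ))^[p] g n) * binomPoly (p + 1)).eval x := by
    ext x
    rw [fSeq_succ_left]
    simp
  rw [h, iteratedDeriv_add (contDiffAt_fSeq hC p n hx) (contDiffAt_eval _ r x),
    iteratedDeriv_eval, Polynomial.iterate_derivative_C_mul]
  simp

/-- The defect of `fSeq` in the equation `Δ f = g` is an increment of `fSeq` of one order less. -/
lemma fSeq_add_one_sub (p : ℕ) {n : ℕ} (hn : 1 ≤ n) (g : ℝ → ℝ) (x : ℝ) :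
    fSeq (p + 1) n g (x + 1) - fSeq (p + 1) n g x =
      g x + (fSeq p (n + 1) g x - fSeq p n g x) := by
  rw [fSeq_succ_sub p hn, eval_newtonPoly]
  obtain ⟨n, rfl⟩ := Nat.exists_eq_add_of_le' hn
  have h1 : ∀ n : ℕ, ∑ k ∈ Finset.Icc 1 n, g (x + 1 + k) =
      ∑ k ∈ Finset.Icc 1 n, g (x + k) + (g (x + ↑(n + 1)) - g (x + 1)) := by
    intro n
    induction n with
    | zero => simp
    | succ n ih =>
      rw [Finset.sum_Icc_succ_top (by omega), Finset.sum_Icc_succ_top (by omega), ih]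
      have : x + 1 + ((n + 1 : ℕ) : ℝ) = x + ((n + 1 + 1 : ℕ) : ℝ) := by push_cast; ring
      rw [this]
      ring
  have h2 : ∀ c : ℕ → ℝ, ∑ j ∈ Finset.Icc 1 (p + 1), Ring.choose (x + 1) j * c (j - 1) =
      ∑ j ∈ Finset.Icc 1 (p + 1), Ring.choose x j * c (j - 1) +
        ∑ j ∈ Finset.range (p + 1), c j * Ring.choose x j := by
    intro c
    have h3 : ∀ f : ℕ → ℝ, ∑ j ∈ Finset.Icc 1 (p + 1), f j =
        ∑ j ∈ Finset.range (p + 1), f (j + 1) := by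
      intro f
      rw [Finset.range_eq_Ico, Finset.sum_Ico_add' f]
      exact Finset.sum_congr (by ext; simp) fun _ _ => rfl
    rw [h3, h3, ← Finset.sum_add_distrib]
    refine Finset.sum_congr rfl fun j _ => ?_
    rw [Ring.choose_succ_succ, Nat.add_sub_cancel]
    ring
  simp only [fSeq, Nat.add_sub_cancel, Finset.sum_sub_distrib]
  rw [h1, h2 fun j => (fwdDiff (1 : ℝ))^[j] g ↑(n + 1)]
  ring

lemma DNat_succ_subset (p : ℕ) : DNat p ⊆ DNat (p + 1) := by
  intro g (hg : Tendsto _ _ _)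
  have h := ((tendsto_add_atTop_iff_nat 1).2 hg).sub hg
  rw [sub_zero] at h
  refine h.congr fun n => ?_
  rw [Function.iterate_succ_apply', fwdDiff, Nat.cast_succ]

lemma DNat_monotone : Monotone DNat := monotone_nat_of_le_succ DNat_succ_subset

lemma C_antitone : Antitone C := fun _ _ h _ hg =>
  ContDiffOn.of_le hg (by exact_mod_cast h)

lemma neg_mem_DNat {p : ℕ} {g : ℝ → ℝ} (hg : g ∈ DNat p) : -g ∈ DNat p := by
  have h : Tendsto _ _ _ := Tendsto.neg hg
  rw [neg_zero] at h
  exact h.congr fun n => by rw [fwdDiff_iter_neg, Pi.neg_apply]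

lemma neg_mem_C {r : ℕ} {g : ℝ → ℝ} (hg : g ∈ C r) : -g ∈ C r := ContDiffOn.neg hg

/-! ### Uniform convergence of the derivatives -/

/-- The derivatives of `fSeq (q + r) n g` are the partial sums of a series that is dominated,
uniformly on bounded sets, by the telescoping series of
`abs_iteratedDeriv_interpolation_error_le`. -/
lemma exists_tendstoUniformlyOn_of_convexOfOrder {g : ℝ → ℝ} {q r : ℕ} {a : ℝ} (ha : 0 < a)
    (hC : g ∈ C r) (hD : g ∈ DNat (q + r)) (hconv : ConvexOfOrder (q + r) (Ici a) g) :
    ∃ G : ℝ → ℝ, ∀ E ⊆ Ioi (0 : ℝ), Bornology.IsBounded E →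
      TendstoUniformlyOn (fun (n : ℕ) x => iteratedDeriv r (fSeq (q + r) n g) x) G atTop E := by
  set f : ℕ → ℝ → ℝ := fun n x => iteratedDeriv r (fSeq (q + r) n g) x with hf
  -- `f 0` only serves as the offset of the partial sums; the bounds concern large `n`
  refine ⟨fun x => f 0 x + ∑' n, (f (n + 1) x - f n x), fun E hE hEb => ?_⟩
  have hconv' := convexOfOrder_iteratedDeriv hconv ha hC
  obtain ⟨b, hb⟩ := hEb.bddAbove
  obtain ⟨N, hN⟩ := exists_nat_gt (max b ((q + r : ℕ) : ℝ))
  have hNb : b < N := (le_max_left _ _).trans_lt hN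
  have hNqr : q + r < N := by exact_mod_cast (le_max_right _ _).trans_lt hN
  have key : ∀ᶠ n : ℕ in atTop, 1 ≤ n ∧ a + (q + 1) ≤ n :=
    (eventually_ge_atTop 1).and
      ((tendsto_natCast_atTop_atTop (R := ℝ)).eventually_ge_atTop (a + (q + 1)))
  set S : ℕ → ℝ := fun n => divDiff (iteratedDeriv r g) (unitGrid q (n - (q + 1))) with hS
  have hSL : ∀ n : ℕ, S (n + (N + (q + 1))) =
      divDiff (iteratedDeriv r g) (unitGrid q (n + N)) := by
    intro n
    simp only [hS]
    congr 2
    push_cast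
    ring
  have hsum : Summable fun n => S (n + (N + (q + 1))) - S n := by
    have hlim : Tendsto (fun n : ℕ => (q + r).descFactorial r *
        ((fwdDiff (1 : ℝ))^[q + r] g n / (q + r).factorial)) atTop (𝓝 0) := by
      have h : Tendsto _ _ _ := hD
      simpa using (h.div_const ((q + r).factorial : ℝ)).const_mul
        ((q + r).descFactorial r : ℝ)
    refine summable_shift_sub (c := 1) ?_ ?_
    · filter_upwards [key, hlim.eventually_le_const zero_lt_one] with n hn h1
      exact (abs_iteratedDeriv_interpolation_error_le ha hC hconv' hn.2 hNqr).2.2.trans h1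
    · filter_upwards [key] with n hn
      rw [hSL]
      exact (abs_iteratedDeriv_interpolation_error_le ha hC hconv' hn.2 hNqr).2.1
  have hbound : ∀ᶠ n in atTop, ∀ x ∈ E, ‖f (n + 1) x - f n x‖ ≤
      N ^ q * (S (n + (N + (q + 1))) - S n) := by
    filter_upwards [key] with n hn x hx
    have hx0 : 0 < x := hE hx
    have h1 := (abs_iteratedDeriv_interpolation_error_le ha hC hconv' hn.2 hNqr).1 x hx0
      ((hb hx).trans_lt hNb)
    have h2 : f (n + 1) x - f n x = -iteratedDeriv r
        (fun y => g (y + n) - (newtonPoly g (q + r) n).eval y) x := by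
      rw [hf, ← iteratedDeriv_sub (contDiffAt_fSeq hC _ _ hx0) (contDiffAt_fSeq hC _ _ hx0),
        ← iteratedDeriv_fun_neg]
      congr 1
      ext y
      exact fSeq_succ_sub _ hn.1 g y
    rw [h2, norm_neg, Real.norm_eq_abs, hSL]
    exact h1
  have hunif := tendstoUniformlyOn_tsum_nat_eventually (hsum.mul_left ((N : ℝ) ^ q)) hbound
  rw [Metric.tendstoUniformlyOn_iff] at hunif ⊢
  intro ε hε
  filter_upwards [hunif ε hε] with n hn x hx
  have h3 := hn x hx
  rw [Finset.sum_range_sub (fun n => f n x)] at h3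
  rw [Real.dist_eq] at h3 ⊢
  convert h3 using 2
  ring

lemma exists_tendstoUniformlyOn_fSeq {g : ℝ → ℝ} {m r : ℕ} (hr : r ≤ m) (hC : g ∈ C r)
    (hD : g ∈ DNat m) (hK : g ∈ K m) :
    ∃ G : ℝ → ℝ, ∀ E ⊆ Ioi (0 : ℝ), Bornology.IsBounded E →
      TendstoUniformlyOn (fun (n : ℕ) x => iteratedDeriv r (fSeq m n g) x) G atTop E := by
  obtain ⟨q, rfl⟩ := Nat.exists_eq_add_of_le' hr
  rcases hK with ⟨a, ha, h⟩ | h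
  · exact exists_tendstoUniformlyOn_of_convexOfOrder ha hC hD h
  · obtain ⟨a, ha, h⟩ := neg_mem_KPlus h
    obtain ⟨G, hG⟩ := exists_tendstoUniformlyOn_of_convexOfOrder ha (neg_mem_C hC)
      (neg_mem_DNat hD) h
    refine ⟨-G, fun E hE hEb => ?_⟩
    have := (hG E hE hEb).neg
    refine this.congr (Eventually.of_forall fun n x _ => ?_)
    simp [fSeq_neg, iteratedDeriv_neg]

/-- Lowering the order of `fSeq` within the range allowed by `DNat` does not change the limit. -/
lemma tendstoUniformlyOn_fSeq_of_le {g : ℝ → ℝ} {p m r : ℕ} (hpm : p ≤ m) (hC : g ∈ C r)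
    (hD : g ∈ DNat p) {G : ℝ → ℝ} {E : Set ℝ} (hE : E ⊆ Ioi 0) (hEb : Bornology.IsBounded E)
    (h : TendstoUniformlyOn (fun (n : ℕ) x => iteratedDeriv r (fSeq m n g) x) G atTop E) :
    TendstoUniformlyOn (fun (n : ℕ) x => iteratedDeriv r (fSeq p n g) x) G atTop E := by
  induction m, hpm using Nat.le_induction with
  | base => exact h
  | succ m hpm ih =>
    refine ih ?_
    set Q := Polynomial.derivative^[r] (binomPoly (m + 1)) with hQ
    obtain ⟨B, hB⟩ : ∃ B : ℝ, ∀ x ∈ E, ‖Q.eval x‖ ≤ B := by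
      obtain ⟨B, hB⟩ := hEb.isCompact_closure.exists_bound_of_continuousOn
        (f := fun x => Q.eval x) Q.continuous.continuousOn
      exact ⟨B, fun x hx => hB x (subset_closure hx)⟩
    have hlim : Tendsto (fun n : ℕ => ‖(fwdDiff (1 : ℝ))^[m] g n‖ * |B|) atTop (𝓝 0) := by
      have h0 : Tendsto _ _ _ := DNat_monotone hpm hD
      simpa using h0.norm.mul_const |B|
    rw [Metric.tendstoUniformlyOn_iff] at h ⊢
    intro ε hε
    filter_upwards [h (ε / 2) (half_pos hε), hlim.eventually_lt_const (half_pos hε)]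
      with n h1 h2 x hx
    have h3 := h1 x hx
    have h4 : ‖(fwdDiff (1 : ℝ))^[m] g n * Q.eval x‖ < ε / 2 := by
      rw [norm_mul]
      exact (mul_le_mul_of_nonneg_left ((hB x hx).trans (le_abs_self B))
        (norm_nonneg _)).trans_lt h2
    rw [iteratedDeriv_fSeq_succ_left hC m n (hE hx), Real.dist_eq] at h3
    rw [Real.dist_eq]
    rw [Real.norm_eq_abs] at h4
    rw [abs_lt] at h3 h4 ⊢
    constructor <;> linarith [h3.1, h3.2, h4.1, h4.2]

lemma tendsto_fSeq_iff_of_le {g : ℝ → ℝ} {p m : ℕ} (hpm : p ≤ m) (hD : g ∈ DNat p) {x y : ℝ} :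
    Tendsto (fun n : ℕ => fSeq m n g x) atTop (𝓝 y) ↔
      Tendsto (fun n : ℕ => fSeq p n g x) atTop (𝓝 y) := by
  induction m, hpm using Nat.le_induction with
  | base => exact Iff.rfl
  | succ m hpm ih =>
    rw [← ih]
    have h0 : Tendsto _ _ _ := DNat_monotone hpm hD
    have h1 := h0.mul_const ((binomPoly (m + 1)).eval x)
    rw [zero_mul] at h1
    simp only [fSeq_succ_left]
    constructor
    · intro h
      simpa using h.sub h1
    · intro h
      simpa using h.add h1

/-- Limits of the derivatives up to order `r`, uniform on bounded sets, are the derivatives of the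
limit. -/
lemma contDiffOn_of_tendstoUniformlyOn {F : ℕ → ℝ → ℝ} {G : ℕ → ℝ → ℝ} {r : ℕ}
    (hF : ∀ n, ∀ x, 0 < x → ContDiffAt ℝ r (F n) x)
    (h : ∀ j ≤ r, ∀ E ⊆ Ioi (0 : ℝ), Bornology.IsBounded E →
      TendstoUniformlyOn (fun n x => iteratedDeriv j (F n) x) (G j) atTop E) :
    ContDiffOn ℝ r (G 0) (Ioi 0) ∧ ∀ j ≤ r, EqOn (iteratedDeriv j (G 0)) (G j) (Ioi 0) := by
  have hloc : ∀ j ≤ r,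
      TendstoLocallyUniformlyOn (fun n x => iteratedDeriv j (F n) x) (G j) atTop (Ioi 0) :=
    fun j hj => (tendstoLocallyUniformlyOn_iff_forall_isCompact isOpen_Ioi).2
      fun E hE hEc => h j hj E hE hEc.isBounded
  have hFd : ∀ j < r, ∀ n, ∀ x, 0 < x →
      HasDerivAt (iteratedDeriv j (F n)) (iteratedDeriv (j + 1) (F n) x) x := by
    intro j hj n x hx
    rw [iteratedDeriv_succ]
    exact (differentiableAt_iteratedDeriv (hF n x hx) hj).hasDerivAt
  have hGd : ∀ j < r, ∀ x ∈ Ioi (0 : ℝ), HasDerivAt (G j) (G (j + 1) x) x := fun j hj x hx =>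
    hasDerivAt_of_tendstoLocallyUniformlyOn isOpen_Ioi (hloc (j + 1) hj)
      (Eventually.of_forall fun n y hy => hFd j hj n y hy)
      (fun y hy => (hloc j hj.le).tendsto_at hy) hx
  have hGc : ∀ j ≤ r, ContinuousOn (G j) (Ioi 0) := by
    intro j hj
    refine (hloc j hj).continuousOn (Frequently.of_forall fun n => ?_)
    have hon : ContDiffOn ℝ r (F n) (Ioi 0) := fun x hx => (hF n x hx).contDiffWithinAt
    exact (hon.continuousOn_iteratedDerivWithin (by exact_mod_cast hj) (uniqueDiffOn_Ioi 0)).congr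
      (iteratedDerivWithin_of_isOpen isOpen_Ioi).symm
  have hEq : ∀ j ≤ r, EqOn (iteratedDeriv j (G 0)) (G j) (Ioi 0) := by
    intro j
    induction j with
    | zero => exact fun _ x _ => by rw [iteratedDeriv_zero]
    | succ j ih =>
      intro hj x hx
      rw [iteratedDeriv_succ,
        ((ih (by omega)).eventuallyEq_of_mem (Ioi_mem_nhds hx)).deriv_eq]
      exact (hGd j (by omega) x hx).deriv
  have hEqW : ∀ j ≤ r, EqOn (iteratedDerivWithin j (G 0) (Ioi 0)) (G j) (Ioi 0) := fun j hj =>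
    (iteratedDerivWithin_of_isOpen isOpen_Ioi).trans (hEq j hj)
  refine ⟨contDiffOn_of_continuousOn_differentiableOn_deriv (n := (r : ℕ∞))
    (fun j hj => ?_) fun j hj => ?_, hEq⟩
  · have hj' : j ≤ r := by exact_mod_cast hj
    exact (hGc j hj').congr (hEqW j hj')
  · have hj' : j < r := by exact_mod_cast hj
    have hdiff : DifferentiableOn ℝ (G j) (Ioi 0) := fun x hx =>
      (hGd j hj' x hx).differentiableAt.differentiableWithinAt
    exact hdiff.congr (hEqW j hj'.le)

/-! ### The limit function -/

/-- On `m + 2` points the polynomial part of `fSeq m n g` contributes nothing to the divided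
difference, and what is left is a sum of translates of `-g`. -/
lemma divDiff_fSeq (m n : ℕ) (g : ℝ → ℝ) {s : Finset ℝ} (hs : s.card = m + 2) :
    divDiff (fSeq m n g) s =
      -(divDiff g s + ∑ k ∈ Finset.Icc 1 (n - 1), divDiff g (s.image (· + (k : ℝ)))) := by
  set P : Polynomial ℝ := Polynomial.C (∑ k ∈ Finset.Icc 1 (n - 1), g k) +
    ∑ j ∈ Finset.Icc 1 m, Polynomial.C ((fwdDiff (1 : ℝ))^[j - 1] g (n : ℝ)) * binomPoly j
    with hP
  have hdeg : P.natDegree ≤ m := by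
    refine Polynomial.natDegree_add_le_of_degree_le
      ((Polynomial.natDegree_C _).le.trans (Nat.zero_le m))
      (Polynomial.natDegree_sum_le_of_forall_le _ _ fun j hj => ?_)
    exact ((Polynomial.natDegree_C_mul_le _ _).trans (natDegree_binomPoly_le j)).trans
      (Finset.mem_Icc.1 hj).2
  have h : ∀ x, fSeq m n g x =
      P.eval x - (g x + ∑ k ∈ Finset.Icc 1 (n - 1), g (x + k)) := by
    intro x
    simp only [fSeq, hP, Polynomial.eval_add, Polynomial.eval_C, Polynomial.eval_finsetSum,
      Polynomial.eval_mul, eval_binomPoly, Finset.sum_sub_distrib]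
    simp only [mul_comm]
    ring
  rw [divDiff_congr fun x _ => h x, divDiff_sub, divDiff_eval_eq_zero P (by omega), zero_sub,
    divDiff_add, divDiff_sum]
  simp only [divDiff_comp_add_right]

lemma mem_KMinus_of_tendsto_fSeq {g F : ℝ → ℝ} {m : ℕ} (hg : g ∈ KPlus m)
    (hF : ∀ x, 0 < x → Tendsto (fun n : ℕ => fSeq m n g x) atTop (𝓝 (F x))) :
    F ∈ KMinus m := by
  obtain ⟨a, ha, hg⟩ := hg
  refine ⟨a, ha, concaveOfOrder_iff_neg.2 (convexOfOrder_iff.2 fun s hs hc => ?_)⟩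
  rw [divDiff_neg, neg_nonneg]
  refine le_of_tendsto (tendsto_divDiff fun x hx => hF x (ha.trans_le (hs hx)))
    (Eventually.of_forall fun n => ?_)
  rw [divDiff_fSeq m n g hc, neg_nonpos]
  refine add_nonneg (convexOfOrder_iff.1 hg s hs hc)
    (Finset.sum_nonneg fun k _ => convexOfOrder_iff.1 hg _ ?_ ?_)
  · intro y hy
    simp only [Finset.coe_image, mem_image, Finset.mem_coe] at hy
    obtain ⟨x, hx, rfl⟩ := hy
    exact (mem_Ici.1 (hs hx)).trans (by simp)
  · rw [Finset.card_image_of_injective _ (add_left_injective _), hc]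

lemma mem_K_of_tendsto_fSeq {g F : ℝ → ℝ} {m : ℕ} (hg : g ∈ K m)
    (hF : ∀ x, 0 < x → Tendsto (fun n : ℕ => fSeq m n g x) atTop (𝓝 (F x))) : F ∈ K m := by
  rcases hg with hg | hg
  · exact Or.inr (mem_KMinus_of_tendsto_fSeq hg hF)
  · have h : -F ∈ KMinus m := mem_KMinus_of_tendsto_fSeq (neg_mem_KPlus hg) fun x hx => by
      simpa [fSeq_neg] using (hF x hx).neg
    simpa using neg_mem_K (Or.inr h : -F ∈ K m)

/-- By monotonicity `Δ^p g(x)` lies between the values of `Δ^p g` at the integers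
`⌊x⌋ - (p + 1)` and `⌊x⌋ + (p + 2)`. -/
lemma mem_DReal_of_mem_KPlus {p : ℕ} {g : ℝ → ℝ} (hD : g ∈ DNat p) (hK : g ∈ KPlus p) :
    g ∈ DReal p := by
  obtain ⟨a, ha, hg⟩ := hK
  have hdiv : ∀ x, (fwdDiff (1 : ℝ))^[p] g x = divDiff g (unitGrid p x) * p.factorial := by
    intro x
    rw [divDiff_unitGrid, div_mul_cancel₀]
    exact_mod_cast p.factorial_ne_zero
  have hcmp : ∀ x y, a ≤ x → x + p < y →
      (fwdDiff (1 : ℝ))^[p] g x ≤ (fwdDiff (1 : ℝ))^[p] g y := by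
    intro x y hx hxy
    have hp : (0 : ℝ) ≤ p := p.cast_nonneg
    rw [hdiv, hdiv]
    refine mul_le_mul_of_nonneg_right (hg.divDiff_le_of_lt (card_unitGrid _ _) (card_unitGrid _ _)
      (fun z hz => hx.trans (le_of_mem_unitGrid hz)) (fun z hz => ?_) fun z hz w hw => ?_)
      (by positivity)
    · have := le_of_mem_unitGrid hz
      simp only [mem_Ici]
      linarith
    · linarith [le_add_of_mem_unitGrid hz, le_of_mem_unitGrid hw]
  have hfloor : Tendsto (fun x : ℝ => ⌊x⌋₊) atTop atTop := tendsto_nat_floor_atTop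
  have hD' : Tendsto _ _ _ := hD
  have hlow := hD'.comp ((tendsto_sub_atTop_nat (p + 1)).comp hfloor)
  have hupp := hD'.comp ((tendsto_add_atTop_nat (p + 2)).comp hfloor)
  refine tendsto_of_tendsto_of_tendsto_of_le_of_le' hlow hupp ?_ ?_
  · filter_upwards [eventually_ge_atTop (a + p + 2)] with x hx
    have hp : (0 : ℝ) ≤ p := p.cast_nonneg
    have h1 := Nat.floor_le (by linarith : 0 ≤ x)
    have h2 := Nat.lt_floor_add_one x
    have h3 : p + 1 ≤ ⌊x⌋₊ := Nat.le_floor (by push_cast; linarith)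
    simp only [Function.comp_apply]
    rw [Nat.cast_sub h3]
    push_cast
    exact hcmp _ _ (by linarith) (by linarith)
  · filter_upwards [eventually_ge_atTop a] with x hx
    have h2 := Nat.lt_floor_add_one x
    simp only [Function.comp_apply]
    push_cast
    exact hcmp _ _ hx (by linarith)

lemma mem_DReal_of_mem_K {p : ℕ} {g : ℝ → ℝ} (hD : g ∈ DNat p) (hK : g ∈ K p) :
    g ∈ DReal p := by
  rcases hK with hK | hK
  · exact mem_DReal_of_mem_KPlus hD hK
  · have h : Tendsto _ _ _ := mem_DReal_of_mem_KPlus (neg_mem_DNat hD) (neg_mem_KPlus hK)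
    have h' := h.neg
    rw [neg_zero] at h'
    exact h'.congr fun x => by rw [fwdDiff_iter_neg, Pi.neg_apply, neg_neg]

lemma fwdDiff_iter_congr {f g : ℝ → ℝ} (h : ∀ x, 0 < x → f x = g x) (p : ℕ) {x : ℝ}
    (hx : 0 < x) : (fwdDiff (1 : ℝ))^[p] f x = (fwdDiff (1 : ℝ))^[p] g x := by
  rw [fwdDiff_iter_eq_sum_shift, fwdDiff_iter_eq_sum_shift]
  refine Finset.sum_congr rfl fun k _ => ?_
  rw [h]
  positivity

/-- `fSeq p n g` converges to `Sig g` for every `p` with `g ∈ DNat p`, once `g ∈ DNat m ∩ K m` for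
some `m ≥ p`. -/
lemma tendsto_fSeq_Sig {g : ℝ → ℝ} {p m : ℕ} (hC : g ∈ C 0) (hpm : p ≤ m) (hD : g ∈ DNat p)
    (hK : g ∈ K m) {x : ℝ} (hx : 0 < x) :
    Tendsto (fun n : ℕ => fSeq p n g x) atTop (𝓝 (Sig g x)) := by
  have hDm : g ∈ DNat m := DNat_monotone hpm hD
  obtain ⟨G, hG⟩ := exists_tendstoUniformlyOn_fSeq (Nat.zero_le m) hC hDm hK
  have hlim : Tendsto (fun n : ℕ => fSeq m n g x) atTop (𝓝 (G x)) := by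
    have := (hG {x} (by simpa using hx) Bornology.isBounded_singleton).tendsto_at
      (mem_singleton x)
    simpa using this
  have hord : order g ∈ {p | g ∈ DNat p ∩ K p} := Nat.sInf_mem ⟨m, hDm, hK⟩
  have hle : order g ≤ m := Nat.sInf_le ⟨hDm, hK⟩
  have hSig : Sig g x = G x := ((tendsto_fSeq_iff_of_le hle hord.1).1 hlim).limUnder_eq
  rw [hSig]
  exact (tendsto_fSeq_iff_of_le hpm hD).1 hlim

/-- The difference equation `Δ (Σ g) = g`. The sequence `fSeq p n g` converges along with
`fSeq (p + 1) n g`, and the difference equation holds for the latter up to an increment of the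
former. -/
lemma Sig_add_one_sub {g : ℝ → ℝ} {p : ℕ} (hD : g ∈ DNat p)
    (hlim : ∀ x, 0 < x → Tendsto (fun n : ℕ => fSeq p n g x) atTop (𝓝 (Sig g x)))
    {x : ℝ} (hx : 0 < x) : Sig g (x + 1) - Sig g x = g x := by
  have hlim' := fun x hx => (tendsto_fSeq_iff_of_le (Nat.le_succ p) hD).2 (hlim x hx)
  have h1 := (hlim' (x + 1) (by linarith)).sub (hlim' x hx)
  have h2 := hlim x hx
  have h3 := (((tendsto_add_atTop_iff_nat 1).2 h2).sub h2).const_add (g x)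
  rw [sub_self, add_zero] at h3
  refine tendsto_nhds_unique h1 (h3.congr' ?_)
  filter_upwards [eventually_ge_atTop 1] with n hn
  exact (fSeq_add_one_sub p hn g x).symm

lemma Sig_mem_DReal {g : ℝ → ℝ} {p : ℕ} (hg : g ∈ DReal p)
    (hdiff : ∀ x, 0 < x → Sig g (x + 1) - Sig g x = g x) : Sig g ∈ DReal (p + 1) := by
  refine Tendsto.congr' ?_ hg
  filter_upwards [eventually_gt_atTop 0] with x hx
  rw [Function.iterate_succ_apply]
  exact (fwdDiff_iter_congr hdiff p hx).symm

end LogGammaType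

theorem theorem7p5 (p r : ℕ) (g : ℝ → ℝ)
    (hC : g ∈ LogGammaType.C r) (hD : g ∈ LogGammaType.DNat p)
    (hK : g ∈ LogGammaType.K (max p r)) :
    -- `Σ g` is the pointwise limit of `fᵖₙ[g]` for this `p`
    (∀ x : ℝ, 0 < x → Tendsto (fun n : ℕ => LogGammaType.fSeq p n g x) atTop
      (𝓝 (LogGammaType.Sig g x))) ∧
    -- (a)
    LogGammaType.Sig g ∈
      LogGammaType.C r ∩ LogGammaType.DReal (p + 1) ∩ LogGammaType.K (max p r) ∧
    -- (b)
    (∀ n : ℕ, 1 ≤ n → LogGammaType.fSeq p n g ∈ LogGammaType.C r) ∧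
    ∀ E : Set ℝ, E ⊆ Ioi 0 → Bornology.IsBounded E →
      TendstoUniformlyOn
        (fun (n : ℕ) (x : ℝ) => iteratedDerivWithin r (LogGammaType.fSeq p n g) (Ioi 0) x)
        (iteratedDerivWithin r (LogGammaType.Sig g) (Ioi 0)) atTop E := by
  open LogGammaType in
  set m := max p r with hm
  have hpm : p ≤ m := le_max_left p r
  have hrm : r ≤ m := le_max_right p r
  have hC0 : g ∈ C 0 := C_antitone (Nat.zero_le r) hC
  have hDm : g ∈ DNat m := DNat_monotone hpm hD
  have hlim : ∀ x : ℝ, 0 < x → Tendsto (fun n : ℕ => fSeq p n g x) atTop (𝓝 (Sig g x)) :=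
    fun x hx => tendsto_fSeq_Sig hC0 hpm hD hK hx
  have hex : ∀ j, ∃ G : ℝ → ℝ, j ≤ r → ∀ E ⊆ Ioi (0 : ℝ), Bornology.IsBounded E →
      TendstoUniformlyOn (fun (n : ℕ) x => iteratedDeriv j (fSeq p n g) x) G atTop E := by
    intro j
    by_cases hj : j ≤ r
    · have hCj : g ∈ C j := C_antitone hj hC
      obtain ⟨G, hG⟩ := exists_tendstoUniformlyOn_fSeq (hj.trans hrm) hCj hDm hK
      exact ⟨G, fun _ E hE hEb =>
        tendstoUniformlyOn_fSeq_of_le hpm hCj hD hE hEb (hG E hE hEb)⟩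
    · exact ⟨0, fun h => absurd h hj⟩
  choose G hG using hex
  obtain ⟨hGC, hGeq⟩ := contDiffOn_of_tendstoUniformlyOn
    (fun n x hx => contDiffAt_fSeq hC p n hx) hG
  have hSig : EqOn (Sig g) (G 0) (Ioi 0) := fun x hx => by
    have := (hG 0 (Nat.zero_le r) {x} (by simpa using hx)
      Bornology.isBounded_singleton).tendsto_at (mem_singleton x)
    simp only [iteratedDeriv_zero] at this
    exact tendsto_nhds_unique (hlim x hx) this
  have hdiff : ∀ x, 0 < x → Sig g (x + 1) - Sig g x = g x := fun x hx =>
    Sig_add_one_sub hD hlim hx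
  refine ⟨hlim, ⟨⟨hGC.congr hSig, Sig_mem_DReal (mem_DReal_of_mem_K hD (K_antitone hpm hK)) hdiff⟩,
    mem_K_of_tendsto_fSeq hK fun x hx => tendsto_fSeq_Sig hC0 le_rfl hDm hK hx⟩,
    fun n _ x hx => (contDiffAt_fSeq hC p n hx).contDiffWithinAt, fun E hE hEb => ?_⟩
  have hcongr : EqOn (iteratedDerivWithin r (Sig g) (Ioi 0)) (G r) (Ioi 0) :=
    ((iteratedDerivWithin_congr hSig).trans (iteratedDerivWithin_of_isOpen isOpen_Ioi)).trans
      (hGeq r le_rfl)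
  refine ((hG r le_rfl E hE hEb).congr_right (hcongr.symm.mono hE)).congr
    (Eventually.of_forall fun n x hx => ?_)
  exact (iteratedDerivWithin_of_isOpen isOpen_Ioi (hE hx)).symm
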